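/- Let $H$ be a complex Hilbert space and let $T : D(T) \to H$ be a linear operator, with domain $D(T)$ a dense subspace of $H$, which is closed (its graph is closed in $H \times H$) and not bounded (there is no constant $C$ with $\|Tx\| \le C\|x\|$ for all $x \in D(T)$). Write $N(T)$ and $R(T)$ for the null space and the range of $T$. Suppose that $T$ is absolutely minimum attaining: for every closed subspace $M$ of $H$ with $D(T) \cap M \neq \{0\}$ there is a vector $x_0 \in D(T) \cap M$ with $\|x_0\| = 1$ and $$\|Tx_0\| = \inf\{\|Tx\| : x \in D(T) \cap M,\ \|x\| = 1\}.$$ ($T$ need not be injective.) Let $T^\dagger$ be the Moore-Penrose inverse of $T$, that is, the operator with domain $D(T^\dagger) = R(T) \oplus R(T)^\perp$ such that $T^\dagger(Tx + z) = x$ for all $x \in D(T) \cap N(T)^\perp$ and $z \in R(T)^\perp$. Then: 1. $T^\dagger$ is compact, that is, $D(T^\dagger) = H$ and $T^\dagger$ is a compact bounded operator on $H$; 2. $N(T)^\perp$ and $R(T)$ are separable. -/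

import Mathlib

noncomputable section

namespace LinearPMap

variable {H₁ H₂ : Type*} [NormedAddCommGroup H₁] [InnerProductSpace ℂ H₁]
  [NormedAddCommGroup H₂] [InnerProductSpace ℂ H₂]

/-- The null space `N(T)`, as a subspace of `H₁`. -/
def nullSpace (T : H₁ →ₗ.[ℂ] H₂) : Submodule ℂ H₁ :=
  (LinearMap.ker T.toFun).map T.domain.subtype

/-- The range space `R(T)`. -/
def rangeSpace (T : H₁ →ₗ.[ℂ] H₂) : Submodule ℂ H₂ :=
  LinearMap.range T.toFun

/-- `T` is bounded on its domain. -/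
def IsBoundedOnDomain (T : H₁ →ₗ.[ℂ] H₂) : Prop :=
  ∃ C : ℝ, ∀ x : T.domain, ‖T x‖ ≤ C * ‖(x : H₁)‖

/-- The minimum modulus `m(T) = inf {‖T x‖ : x ∈ D(T), ‖x‖ = 1}`. -/
def minimumModulus (T : H₁ →ₗ.[ℂ] H₂) : ℝ :=
  sInf {r : ℝ | ∃ x : T.domain, ‖(x : H₁)‖ = 1 ∧ ‖T x‖ = r}

/-- `T` is minimum attaining: some unit vector `x₀` of `D(T)` satisfies `‖T x₀‖ = m(T)`. -/
def IsMinimumAttaining (T : H₁ →ₗ.[ℂ] H₂) : Prop :=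
  ∃ x₀ : T.domain, ‖(x₀ : H₁)‖ = 1 ∧ ‖T x₀‖ = T.minimumModulus

/-- `T` is absolutely minimum attaining: for every closed subspace `M` the restriction
`T|_M : D(T) ∩ M → H₂` is minimum attaining, provided that it lives on a nonzero space, that is,
`D(T) ∩ M ≠ {0}`. (If `D(T) ∩ M = {0}`, there is no unit vector in the domain of `T|_M`; every
operator that is not everywhere defined has such a restriction to a line.) -/
def IsAbsolutelyMinimumAttaining (T : H₁ →ₗ.[ℂ] H₂) : Prop :=
  ∀ M : Submodule ℂ H₁, _root_.IsClosed (M : Set H₁) → (T.domRestrict M).domain ≠ ⊥ →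
    (T.domRestrict M).IsMinimumAttaining

/-- The graph of the Moore-Penrose inverse: the pairs `(T x + z, x)` with
`x ∈ D(T) ∩ N(T)ᗮ` and `z ∈ R(T)ᗮ`. -/
def moorePenroseGraph (T : H₁ →ₗ.[ℂ] H₂) : Submodule ℂ (H₂ × H₁) where
  carrier := {p | ∃ x : T.domain, ∃ z ∈ T.rangeSpaceᗮ,
    (x : H₁) ∈ T.nullSpaceᗮ ∧ p = (T x + z, (x : H₁))}
  zero_mem' := ⟨0, 0, Submodule.zero_mem _, by simp, by ext <;> simp⟩
  add_mem' := by
    rintro _ _ ⟨x, z, hz, hx, rfl⟩ ⟨x', z', hz', hx', rfl⟩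
    refine ⟨x + x', z + z', Submodule.add_mem _ hz hz', Submodule.add_mem _ hx hx', ?_⟩
    ext
    · simp only [Prod.mk_add_mk, LinearPMap.map_add]; abel
    · simp
  smul_mem' := by
    rintro c _ ⟨x, z, hz, hx, rfl⟩
    refine ⟨c • x, c • z, Submodule.smul_mem _ c hz, Submodule.smul_mem _ c hx, ?_⟩
    ext
    · simp only [Prod.smul_mk, LinearPMap.map_smul, smul_add]
    · simp

/-- The Moore-Penrose inverse `T†`: the operator with domain `R(T) ⊕ R(T)ᗮ` which sends
`T x + z` to `x` for `x ∈ D(T) ∩ N(T)ᗮ` and `z ∈ R(T)ᗮ`. -/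
def moorePenrose (T : H₁ →ₗ.[ℂ] H₂) : H₂ →ₗ.[ℂ] H₁ :=
  T.moorePenroseGraph.toLinearPMap

/-- `S` is a compact operator in the usual sense: an everywhere defined bounded operator that
maps bounded sets to relatively compact sets. -/
def IsCompactEverywhereDefined (S : H₂ →ₗ.[ℂ] H₁) : Prop :=
  ∃ K : H₂ →L[ℂ] H₁, IsCompactOperator K ∧ S = (K : H₂ →ₗ[ℂ] H₁).toPMap ⊤

/-- The defining properties of the Moore-Penrose inverse: `D(S) = R(T) ⊕ R(T)ᗮ`,
`T S y` is the projection of `y` to the closure of `R(T)`, `S T x` is the projection of `x`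
to `N(T)ᗮ`, and `N(S) = R(T)ᗮ`. -/
structure IsMoorePenroseInverse [CompleteSpace H₁] [CompleteSpace H₂]
    (T : H₁ →ₗ.[ℂ] H₂) (S : H₂ →ₗ.[ℂ] H₁) : Prop where
  domain_eq : S.domain = T.rangeSpace ⊔ T.rangeSpaceᗮ
  apply_inverse : ∀ y : S.domain, ∃ h : S y ∈ T.domain,
    T ⟨S y, h⟩ = T.rangeSpace.topologicalClosure.starProjection (y : H₂)
  inverse_apply : ∀ x : T.domain, ∃ h : T x ∈ S.domain,
    S ⟨T x, h⟩ = T.nullSpaceᗮ.starProjection (x : H₁)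
  nullSpace_eq : S.nullSpace = T.rangeSpaceᗮ

theorem mem_nullSpace {T : H₁ →ₗ.[ℂ] H₂} {x : H₁} :
    x ∈ T.nullSpace ↔ ∃ h : x ∈ T.domain, T ⟨x, h⟩ = 0 := by
  constructor
  · rintro ⟨y, hy, rfl⟩
    exact ⟨y.2, hy⟩
  · rintro ⟨h, hx⟩
    exact ⟨⟨x, h⟩, hx, rfl⟩

theorem mem_rangeSpace (T : H₁ →ₗ.[ℂ] H₂) (x : T.domain) : T x ∈ T.rangeSpace :=
  ⟨x, rfl⟩

theorem moorePenroseGraph_functional (T : H₁ →ₗ.[ℂ] H₂) :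
    ∀ p ∈ T.moorePenroseGraph, p.1 = 0 → p.2 = 0 := by
  rintro _ ⟨x, z, hz, hx, rfl⟩ h
  have h0 : T x = -z := eq_neg_of_add_eq_zero_left h
  have h1 : T x ∈ T.rangeSpaceᗮ := h0 ▸ Submodule.neg_mem _ hz
  have h2 : T x = 0 := by
    have := Submodule.inner_right_of_mem_orthogonal (T.mem_rangeSpace x) h1
    exact inner_self_eq_zero.1 this
  have h3 : (x : H₁) ∈ T.nullSpace := mem_nullSpace.2 ⟨x.2, h2⟩
  exact inner_self_eq_zero.1 (Submodule.inner_right_of_mem_orthogonal h3 hx)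

theorem mem_graph_moorePenrose {T : H₁ →ₗ.[ℂ] H₂} {p : H₂ × H₁} :
    p ∈ T.moorePenrose.graph ↔ p ∈ T.moorePenroseGraph := by
  rw [moorePenrose, Submodule.toLinearPMap_graph_eq _ T.moorePenroseGraph_functional]

theorem isClosed_nullSpace {T : H₁ →ₗ.[ℂ] H₂} (hT : T.IsClosed) :
    _root_.IsClosed (T.nullSpace : Set H₁) := by
  have : (T.nullSpace : Set H₁) = (fun x : H₁ => (x, (0 : H₂))) ⁻¹' (T.graph : Set (H₁ × H₂)) := by
    ext x
    simp only [SetLike.mem_coe, mem_nullSpace, Set.mem_preimage, mem_graph_iff]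
    constructor
    · rintro ⟨h, hx⟩
      exact ⟨⟨x, h⟩, rfl, hx⟩
    · rintro ⟨y, rfl, hy⟩
      exact ⟨y.2, hy⟩
  rw [this]
  exact IsClosed.preimage (by fun_prop) hT

/-- For a closed operator, `T.moorePenrose` is the Moore-Penrose inverse. -/
theorem isMoorePenroseInverse_moorePenrose [CompleteSpace H₁] [CompleteSpace H₂]
    {T : H₁ →ₗ.[ℂ] H₂} (hT : T.IsClosed) : IsMoorePenroseInverse T T.moorePenrose := by
  have hN : CompleteSpace T.nullSpace := (isClosed_nullSpace hT).completeSpace_coe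
  -- every `x ∈ D(T)` has its projection to `N(T)ᗮ` in `D(T)`, with the same image
  have key : ∀ x : T.domain, ∃ h : T.nullSpaceᗮ.starProjection (x : H₁) ∈ T.domain,
      T ⟨_, h⟩ = T x := by
    intro x
    obtain ⟨hn, hn0⟩ := mem_nullSpace.1 (Submodule.starProjection_apply_mem T.nullSpace (x : H₁))
    have e : T.nullSpaceᗮ.starProjection (x : H₁)
        = (x - ⟨T.nullSpace.starProjection (x : H₁), hn⟩ : T.domain) := by
      rw [Submodule.starProjection_orthogonal_val]; rfl
    refine ⟨e ▸ Subtype.property _, ?_⟩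
    have : (⟨_, e ▸ Subtype.property _⟩ : T.domain)
      = x - ⟨T.nullSpace.starProjection (x : H₁), hn⟩ := Subtype.ext e
    rw [this, LinearPMap.map_sub, hn0, sub_zero]
  have mk : ∀ (x : T.domain) (z : H₂), z ∈ T.rangeSpaceᗮ →
      (T x + z, T.nullSpaceᗮ.starProjection (x : H₁)) ∈ T.moorePenrose.graph := by
    intro x z hz
    obtain ⟨h, hx⟩ := key x
    exact mem_graph_moorePenrose.2
      ⟨⟨_, h⟩, z, hz, Submodule.starProjection_apply_mem _ _, by rw [hx]⟩
  refine ⟨?_, ?_, ?_, ?_⟩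
  · ext y
    rw [mem_domain_iff, Submodule.mem_sup]
    constructor
    · rintro ⟨x, hx⟩
      obtain ⟨x', z, hz, -, e⟩ := mem_graph_moorePenrose.1 hx
      exact ⟨T x', T.mem_rangeSpace x', z, hz, (congrArg Prod.fst e).symm⟩
    · rintro ⟨_, ⟨x, rfl⟩, z, hz, rfl⟩
      exact ⟨_, mk x z hz⟩
  · intro y
    obtain ⟨x, z, hz, hx, e⟩ := mem_graph_moorePenrose.1 (T.moorePenrose.mem_graph y)
    have e1 : (y : H₂) = T x + z := congrArg Prod.fst e
    have e2 : T.moorePenrose y = x := congrArg Prod.snd e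
    refine ⟨e2 ▸ x.2, ?_⟩
    have : (⟨T.moorePenrose y, e2 ▸ x.2⟩ : T.domain) = x := Subtype.ext e2
    rw [this]
    refine (Submodule.eq_starProjection_of_mem_of_inner_eq_zero
      (T.rangeSpace.le_topologicalClosure (T.mem_rangeSpace x)) ?_).symm
    intro w hw
    rw [e1, add_sub_cancel_left]
    rw [← Submodule.orthogonal_closure] at hz
    exact Submodule.inner_left_of_mem_orthogonal hw hz
  · intro x
    have h := mk x 0 (Submodule.zero_mem _)
    rw [add_zero] at h
    obtain ⟨y, hy, hy'⟩ := (mem_graph_iff _).1 h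
    dsimp only at hy hy'
    refine ⟨hy ▸ y.2, ?_⟩
    have : (⟨T x, hy ▸ y.2⟩ : T.moorePenrose.domain) = y := Subtype.ext hy.symm
    rw [this, hy']
  · ext y
    rw [mem_nullSpace]
    constructor
    · rintro ⟨h, h0⟩
      have := T.moorePenrose.mem_graph ⟨y, h⟩
      rw [h0] at this
      obtain ⟨x, z, hz, -, e⟩ := mem_graph_moorePenrose.1 this
      have e1 : y = T x + z := congrArg Prod.fst e
      have e2 : x = 0 := Subtype.ext (congrArg Prod.snd e).symm
      rw [e1, e2, LinearPMap.map_zero, zero_add]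
      exact hz
    · intro hy
      have h := mk 0 y hy
      rw [LinearPMap.map_zero, zero_add] at h
      obtain ⟨y', e1, e2⟩ := (mem_graph_iff _).1 h
      simp only [Submodule.coe_zero, _root_.map_zero] at e1 e2
      refine ⟨e1 ▸ y'.2, ?_⟩
      have : (⟨y, e1 ▸ y'.2⟩ : T.moorePenrose.domain) = y' := Subtype.ext e1.symm
      rw [this, e2]

/-- The Moore-Penrose inverse is determined by its defining properties. -/
theorem IsMoorePenroseInverse.unique [CompleteSpace H₁] [CompleteSpace H₂]
    {T : H₁ →ₗ.[ℂ] H₂} {S S' : H₂ →ₗ.[ℂ] H₁} (hS : IsMoorePenroseInverse T S)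
    (hS' : IsMoorePenroseInverse T S') : S = S' := by
  refine LinearPMap.ext (hS.domain_eq.trans hS'.domain_eq.symm) ?_
  intro y hy hy'
  obtain ⟨_, ⟨x, rfl⟩, z, hz, e⟩ := Submodule.mem_sup.1 (hS.domain_eq ▸ hy)
  have aux : ∀ R : H₂ →ₗ.[ℂ] H₁, IsMoorePenroseInverse T R → ∀ h : y ∈ R.domain,
      R ⟨y, h⟩ = T.nullSpaceᗮ.starProjection (x : H₁) := by
    intro R hR h
    obtain ⟨h1, e1⟩ := hR.inverse_apply x
    obtain ⟨h2, e2⟩ := mem_nullSpace.1 (hR.nullSpace_eq ▸ hz : z ∈ R.nullSpace)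
    have : (⟨y, h⟩ : R.domain) = ⟨T x, h1⟩ + ⟨z, h2⟩ := Subtype.ext e.symm
    rw [this, LinearPMap.map_add, e1, e2, add_zero]
  rw [aux S hS hy, aux S' hS' hy']

end LinearPMap

end

/-! Give the graph of `T` its Hilbert norm and let `P` be its first projection, an injective bounded
operator with range `D(T)`. Since the graph norm satisfies `‖g‖² = ‖x‖² + ‖T x‖²` at `g = (x, T x)`,
minimizing `‖T x‖` over unit vectors of `D(T) ∩ M` is the same as maximizing `‖P g‖ / ‖g‖` over `P g
∈ M`. So `P` attains its norm on the preimage of every closed `M` that meets `D(T)` nontrivially.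

`P` is not bounded below, as `T` is unbounded. If it were not compact either,
`exists_orthonormal_strictMono_norm` would give orthonormal `gₙ` with orthogonal images and `‖P gₙ‖`
strictly increasing. On the closed span `V` of the `gₙ` the supremum of `‖P v‖ / ‖v‖` is not
attained, while `P V` is closed: a contradiction with `M = P V`. Hence `P` is compact.

A subsequence argument then bounds `T` below on `N(T)ᗮ`, so `R(T)` is closed and `T†` is bounded and
everywhere defined. It factors as a bounded map into the graph followed by `P`, hence is compact.
Separability holds because `D(T)`, the range of a compact operator, is dense in `H`. -/

noncomputable section

open scoped InnerProductSpace Topology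
open Filter

/-! ### Compactness and lower bounds modulo finite-dimensional subspaces -/

namespace ContinuousLinearMap

variable {𝕜 E F : Type*} [RCLike 𝕜] [NormedAddCommGroup E] [InnerProductSpace 𝕜 E]
  [NormedAddCommGroup F] [InnerProductSpace 𝕜 F]

/-- If `J` is small on the orthogonal complements of finite-dimensional subspaces, it is compact. -/
theorem isCompactOperator_of_forall_exists_le [CompleteSpace F] (J : E →L[𝕜] F)
    (h : ∀ ε > 0, ∃ V : Submodule 𝕜 E, FiniteDimensional 𝕜 V ∧
      ∀ u ∈ Vᗮ, ‖J u‖ ≤ ε * ‖u‖) : IsCompactOperator J := by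
  -- Compact operators are norm closed, and the finite-rank operators `J ∘ P_V` approximate `J`.
  have hcl := isClosed_setOfPred_isCompactOperator (σ₁₂ := RingHom.id 𝕜) (M₁ := E) (M₂ := F)
  refine hcl.closure_subset (Metric.mem_closure_iff.2 fun ε hε => ?_)
  obtain ⟨V, hV, hle⟩ := h (ε / 2) (by positivity)
  have hproper : ProperSpace V := FiniteDimensional.proper_rclike 𝕜 V
  refine ⟨J ∘L V.starProjection, ?_, ?_⟩
  · exact (isCompactOperator_of_locallyCompactSpace_rng
      (J ∘L V.subtypeL : V →L[𝕜] F)).comp_clm V.orthogonalProjectionOnto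
  · refine lt_of_le_of_lt ?_ (half_lt_self hε)
    rw [dist_eq_norm]
    refine ContinuousLinearMap.opNorm_le_bound _ (by positivity) fun x => ?_
    have e : (J - J ∘L V.starProjection) x = J (Vᗮ.starProjection x) := by
      rw [Submodule.starProjection_orthogonal_val]
      simp
    rw [e]
    refine (hle _ (Submodule.starProjection_apply_mem _ _)).trans ?_
    gcongr
    exact Submodule.norm_starProjection_apply_le _ _

/-- An injective operator that is bounded below on the orthogonal complement of a
finite-dimensional subspace is bounded below. -/
theorem exists_antilipschitz_of_orthogonal [CompleteSpace E] [CompleteSpace F] (J : E →L[𝕜] F)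
    (hJ : Function.Injective J) (V : Submodule 𝕜 E) [FiniteDimensional 𝕜 V] {t : ℝ} (ht : 0 < t)
    (h : ∀ u ∈ Vᗮ, t * ‖u‖ ≤ ‖J u‖) : ∃ K, AntilipschitzWith K J := by
  have ha : AntilipschitzWith (Real.toNNReal t⁻¹) (J ∘L Vᗮ.subtypeL) :=
    AddMonoidHomClass.antilipschitz_of_bound _ fun u => by
      rw [Real.coe_toNNReal _ (by positivity), inv_mul_eq_div, le_div_iff₀ ht, mul_comm]
      exact h u u.2
  have hcl := ha.isClosed_range (J ∘L Vᗮ.subtypeL).uniformContinuous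
  have e1 : Set.range (J ∘L Vᗮ.subtypeL) = (Vᗮ.map (J : E →ₗ[𝕜] F) : Submodule 𝕜 F) := by
    ext y; simp
  rw [e1] at hcl
  -- `J Vᗮ` is closed and `J V` is finite-dimensional, so the range `J Vᗮ + J V` is closed.
  have hsup := Submodule.isClosed_sup_finiteDimensional _ (V.map (J : E →ₗ[𝕜] F)) hcl
  rw [← Submodule.map_sup, sup_comm, Submodule.sup_orthogonal_of_hasOrthogonalProjection,
    Submodule.map_top] at hsup
  exact J.antilipschitz_of_injective_of_isClosed_range hJ hsup

/-- Intermediate values of `‖J w‖` on the unit sphere of a subspace. -/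
theorem exists_mem_norm_eq_one_of_lt (J : E →L[𝕜] F) (W : Submodule 𝕜 E) {t : ℝ} (ht : 0 < t)
    {u v : E} (hu : u ∈ W) (hv : v ∈ W) (hut : t * ‖u‖ < ‖J u‖) (hvt : ‖J v‖ < t * ‖v‖) :
    ∃ w ∈ W, ‖w‖ = 1 ∧ ‖J w‖ = t := by
  let w : ℝ → E := fun s => ((1 - s : ℝ) : 𝕜) • u + (s : 𝕜) • v
  have hw : Continuous w := by fun_prop
  obtain ⟨s, hs, hs0⟩ : (0 : ℝ) ∈ (fun s => ‖J (w s)‖ - t * ‖w s‖) '' Set.Icc (0 : ℝ) 1 := by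
    refine intermediate_value_Icc' zero_le_one (by fun_prop) ⟨?_, ?_⟩
    · simpa [w] using hvt.le
    · simpa [w] using hut.le
  have hJw : ‖J (w s)‖ = t * ‖w s‖ := sub_eq_zero.1 hs0
  -- If the segment met `0`, then `u` and `v` would be proportional and `‖J ·‖ / ‖·‖` would agree on
  -- them.
  have hws : w s ≠ 0 := by
    intro h0
    have e : ((1 - s : ℝ) : 𝕜) • u = -((s : 𝕜) • v) := eq_neg_of_add_eq_zero_left h0
    have n1 : (1 - s) * ‖u‖ = s * ‖v‖ := by
      have := congrArg norm e
      rwa [norm_neg, norm_smul, norm_smul, RCLike.norm_ofReal, RCLike.norm_ofReal,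
        abs_of_nonneg hs.1, abs_of_nonneg (sub_nonneg.2 hs.2)] at this
    have n2 : (1 - s) * ‖J u‖ = s * ‖J v‖ := by
      have := congrArg (fun x => ‖J x‖) e
      simp only [map_neg, map_smul] at this
      rwa [norm_neg, norm_smul, norm_smul, RCLike.norm_ofReal, RCLike.norm_ofReal,
        abs_of_nonneg hs.1, abs_of_nonneg (sub_nonneg.2 hs.2)] at this
    rcases hs.1.eq_or_lt with rfl | hpos
    · nlinarith [norm_nonneg u, norm_nonneg v]
    · nlinarith [mul_lt_mul_of_pos_left hvt hpos,
        mul_le_mul_of_nonneg_left hut.le (sub_nonneg.2 hs.2)]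
  have hn : ‖w s‖ ≠ 0 := norm_ne_zero_iff.2 hws
  refine ⟨((‖w s‖⁻¹ : ℝ) : 𝕜) • w s, W.smul_mem _ (W.add_mem (W.smul_mem _ hu) (W.smul_mem _ hv)),
    ?_, ?_⟩
  · rw [norm_smul, RCLike.norm_ofReal, abs_of_nonneg (by positivity), inv_mul_cancel₀ hn]
  · rw [map_smul, norm_smul, RCLike.norm_ofReal, abs_of_nonneg (by positivity), hJw]
    field_simp

/-! ### Orthonormal sequences with orthogonal images -/

variable [CompleteSpace E]

/-- Parseval's identity for `v` and `J v`, where `v` lies in the closed span of an orthonormal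
sequence with orthogonal images. -/
theorem hasSum_norm_sq_of_mem_closure_span (J : E →L[𝕜] F) {g : ℕ → E} (hg : Orthonormal 𝕜 g)
    (hJg : ∀ m n, m ≠ n → ⟪J (g m), J (g n)⟫_𝕜 = 0) {v : E}
    (hv : v ∈ (Submodule.span 𝕜 (Set.range g)).topologicalClosure) :
    HasSum (fun n => ‖⟪g n, v⟫_𝕜‖ ^ 2) (‖v‖ ^ 2) ∧
      HasSum (fun n => ‖⟪g n, v⟫_𝕜‖ ^ 2 * ‖J (g n)‖ ^ 2) (‖J v‖ ^ 2) := by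
  have hsum : HasSum (fun n => ⟪g n, v⟫_𝕜 • g n) v := by
    let V := (Submodule.span 𝕜 (Set.range g)).topologicalClosure
    have : CompleteSpace V := (Submodule.isClosed_topologicalClosure _).completeSpace_coe
    let g' : ℕ → V := fun n =>
      ⟨g n, Submodule.le_topologicalClosure _ (Submodule.subset_span ⟨n, rfl⟩)⟩
    have hg' : Orthonormal 𝕜 g' := V.subtypeₗᵢ.orthonormal_comp_iff.1 hg
    have hbot : (Submodule.span 𝕜 (Set.range g'))ᗮ = ⊥ := by
      refine (Submodule.eq_bot_iff _).2 fun x hx => ?_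
      have h1 : (x : E) ∈ (Submodule.span 𝕜 (Set.range g))ᗮ := by
        refine (Submodule.mem_orthogonal _ _).2 fun u hu => ?_
        induction hu using Submodule.span_induction with
        | mem u hu =>
          obtain ⟨n, rfl⟩ := hu
          have hn : g' n ∈ Submodule.span 𝕜 (Set.range g') :=
            Submodule.subset_span (Set.mem_range_self n)
          have h0 : ⟪g' n, x⟫_𝕜 = 0 := Submodule.inner_right_of_mem_orthogonal hn hx
          exact h0
        | zero => simp
        | add a b _ _ ha hb => rw [inner_add_left, ha, hb, add_zero]
        | smul c a _ ha => rw [inner_smul_left, ha, mul_zero]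
      rw [← Submodule.orthogonal_closure] at h1
      exact Subtype.ext (inner_self_eq_zero.1 (Submodule.inner_right_of_mem_orthogonal x.2 h1))
    let b := HilbertBasis.mkOfOrthogonalEqBot hg' hbot
    have h1 := (b.hasSum_repr (⟨v, hv⟩ : V)).mapL V.subtypeL
    simpa [b, HilbertBasis.repr_apply_apply, g'] using h1
  have hJsum : HasSum (fun n => ⟪g n, v⟫_𝕜 • J (g n)) (J v) := by
    simpa using J.hasSum hsum
  have hinner : ∀ n, ⟪J (g n), J v⟫_𝕜 = ⟪g n, v⟫_𝕜 * ((‖J (g n)‖ ^ 2 : ℝ) : 𝕜) := by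
    intro n
    have h1 := hJsum.mapL (innerSL 𝕜 (J (g n)))
    refine h1.unique ?_
    have h2 := hasSum_single (f := fun m => innerSL 𝕜 (J (g n)) (⟪g m, v⟫_𝕜 • J (g m))) n
      (fun m hm => by simp [hJg n m hm.symm])
    simpa [inner_self_eq_norm_sq_to_K] using h2
  constructor
  · have h1 := (hsum.mapL (innerSL 𝕜 v)).mapL (RCLike.reCLM (K := 𝕜))
    have e1 : (fun n => ‖⟪g n, v⟫_𝕜‖ ^ 2) =
        fun n => RCLike.reCLM (innerSL 𝕜 v (⟪g n, v⟫_𝕜 • g n)) := by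
      ext n
      rw [innerSL_apply_apply, inner_smul_right, RCLike.reCLM_apply, inner_mul_symm_re_eq_norm,
        norm_mul, norm_inner_symm v, sq]
    have e2 : ‖v‖ ^ 2 = RCLike.reCLM (innerSL 𝕜 v v) := by
      rw [innerSL_apply_apply, RCLike.reCLM_apply, inner_self_eq_norm_sq]
    rw [e1, e2]
    exact h1
  · have h1 := (hJsum.mapL (innerSL 𝕜 (J v))).mapL (RCLike.reCLM (K := 𝕜))
    have e1 : (fun n => ‖⟪g n, v⟫_𝕜‖ ^ 2 * ‖J (g n)‖ ^ 2) =
        fun n => RCLike.reCLM (innerSL 𝕜 (J v) (⟪g n, v⟫_𝕜 • J (g n))) := by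
      ext n
      rw [innerSL_apply_apply, inner_smul_right, RCLike.reCLM_apply, ← inner_conj_symm (J v),
        hinner, RingHom.map_mul, RCLike.conj_ofReal, ← mul_assoc, RCLike.mul_conj, ← RCLike.ofReal_pow,
        ← RCLike.ofReal_mul, RCLike.ofReal_re]
    have e2 : ‖J v‖ ^ 2 = RCLike.reCLM (innerSL 𝕜 (J v) (J v)) := by
      rw [innerSL_apply_apply, RCLike.reCLM_apply, inner_self_eq_norm_sq]
    rw [e1, e2]
    exact h1

variable [CompleteSpace F]

/-- An injective operator that is neither compact nor bounded below has an orthonormal sequence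
with orthogonal images of strictly increasing norms. -/
theorem exists_orthonormal_strictMono_norm (J : E →L[𝕜] F) (hJ : Function.Injective J)
    (hbelow : ¬ ∃ K, AntilipschitzWith K J) (hcomp : ¬ IsCompactOperator J) :
    ∃ g : ℕ → E, Orthonormal 𝕜 g ∧ (∀ m n, m ≠ n → ⟪J (g m), J (g n)⟫_𝕜 = 0) ∧
      StrictMono (fun n => ‖J (g n)‖) := by
  have hε : ∃ ε > 0, ∀ V : Submodule 𝕜 E, FiniteDimensional 𝕜 V →
      ∃ u ∈ Vᗮ, ε * ‖u‖ < ‖J u‖ := by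
    by_contra! H
    exact hcomp (J.isCompactOperator_of_forall_exists_le H)
  obtain ⟨ε, hε, hlarge⟩ := hε
  have key : ∀ s : Finset E, ∀ t, 0 < t → t < ε → ∃ y, ‖y‖ = 1 ∧ ‖J y‖ = t ∧
      ∀ x ∈ s, ⟪x, y⟫_𝕜 = 0 ∧ ⟪J x, J y⟫_𝕜 = 0 := by
    classical
    intro s t ht htε
    -- Including `J* J x` makes `w ∈ Vᗮ` satisfy `J w ⟂ J x` as well as `w ⟂ x`.
    let V := Submodule.span 𝕜 ((s ∪ s.image fun x => adjoint J (J x) : Finset E) : Set E)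
    have : FiniteDimensional 𝕜 V := FiniteDimensional.span_finset 𝕜 _
    obtain ⟨u, hu, hu'⟩ := hlarge V this
    obtain ⟨v, hv, hv'⟩ : ∃ v ∈ Vᗮ, ‖J v‖ < t * ‖v‖ := by
      by_contra! H
      exact hbelow (J.exists_antilipschitz_of_orthogonal hJ V ht H)
    obtain ⟨w, hw, hw1, hwt⟩ := J.exists_mem_norm_eq_one_of_lt Vᗮ ht hu hv
      (lt_of_le_of_lt (by gcongr) hu') hv'
    refine ⟨w, hw1, hwt, fun x hx => ⟨?_, ?_⟩⟩
    · have hxV : x ∈ V := Submodule.subset_span (by simp [hx])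
      exact Submodule.inner_right_of_mem_orthogonal hxV hw
    · have hxV : adjoint J (J x) ∈ V :=
        Submodule.subset_span (Finset.mem_coe.2 (Finset.mem_union_right _
          (Finset.mem_image_of_mem (fun x => adjoint J (J x)) hx)))
      rw [← adjoint_inner_left]
      exact Submodule.inner_right_of_mem_orthogonal hxV hw
  obtain ⟨g, hg, hg'⟩ := exists_seq_of_forall_finset_exists
    -- The strict bound by `ε` always leaves room for a next value `t` above the finitely many
    -- earlier norms.
    (fun x : E => ‖x‖ = 1 ∧ ‖J x‖ < ε)
    (fun x y => (⟪x, y⟫_𝕜 = 0 ∧ ⟪J x, J y⟫_𝕜 = 0) ∧ ‖J x‖ < ‖J y‖) (by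
      intro s hs
      have h1 : ∀ᶠ t in 𝓝[<] ε, ∀ x ∈ s, ‖J x‖ < t := by
        rw [Filter.eventually_all_finset]
        intro x hx
        exact (eventually_gt_nhds (hs x hx).2).filter_mono nhdsWithin_le_nhds
      have h2 : ∀ᶠ t in 𝓝[<] ε, 0 < t :=
        (eventually_gt_nhds hε).filter_mono nhdsWithin_le_nhds
      have h3 : ∀ᶠ t in 𝓝[<] ε, t < ε := eventually_mem_nhdsWithin
      obtain ⟨t, ⟨ht1, ht2⟩, ht3⟩ := ((h1.and h2).and h3).exists
      obtain ⟨y, hy1, hyt, hy⟩ := key s t ht2 ht3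
      exact ⟨y, ⟨hy1, hyt ▸ ht3⟩, fun x hx => ⟨hy x hx, hyt ▸ ht1 x hx⟩⟩)
  refine ⟨g, ⟨fun n => (hg n).1, fun m n hmn => ?_⟩, fun m n hmn => ?_,
    fun m n hmn => (hg' m n hmn).2⟩
  · rcases hmn.lt_or_gt with h | h
    · exact (hg' m n h).1.1
    · exact inner_eq_zero_symm.1 (hg' n m h).1.1
  · rcases hmn.lt_or_gt with h | h
    · exact (hg' m n h).1.2
    · exact inner_eq_zero_symm.1 (hg' n m h).1.2

/-- An injective operator that is neither compact nor bounded below fails to attain its norm on the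
preimage of some closed subspace. -/
theorem exists_closed_not_norm_attaining (J : E →L[𝕜] F) (hJ : Function.Injective J)
    (hbelow : ¬ ∃ K, AntilipschitzWith K J) (hcomp : ¬ IsCompactOperator J) :
    ∃ M : Submodule 𝕜 F, IsClosed (M : Set F) ∧ (∃ g ≠ 0, J g ∈ M) ∧
      ∀ v ≠ 0, J v ∈ M → ∃ g, J g ∈ M ∧ ‖J v‖ * ‖g‖ < ‖J g‖ * ‖v‖ := by
  obtain ⟨g, hg, hJg, hmono⟩ := J.exists_orthonormal_strictMono_norm hJ hbelow hcomp
  let V := (Submodule.span 𝕜 (Set.range g)).topologicalClosure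
  have hgV : ∀ n, g n ∈ V := fun n =>
    Submodule.le_topologicalClosure _ (Submodule.subset_span ⟨n, rfl⟩)
  have hVcl : IsClosed (V : Set E) := Submodule.isClosed_topologicalClosure _
  have : CompleteSpace V := hVcl.completeSpace_coe
  have hg0 : ∀ n, g n ≠ 0 := hg.ne_zero
  let a := ‖J (g 0)‖
  have ha : 0 < a := norm_pos_iff.2 ((map_ne_zero_iff J hJ).2 (hg0 0))
  -- The first norm is the smallest, so Parseval bounds `J` below on `V` and makes `J V` closed.
  have hle : ∀ v ∈ V, a * ‖v‖ ≤ ‖J v‖ := by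
    intro v hv
    obtain ⟨h1, h2⟩ := J.hasSum_norm_sq_of_mem_closure_span hg hJg hv
    refine le_of_sq_le_sq ?_ (norm_nonneg _)
    rw [mul_pow, mul_comm]
    refine hasSum_le (fun n => ?_) (h1.mul_right (a ^ 2)) h2
    gcongr
    exact hmono.monotone n.zero_le
  have hanti : AntilipschitzWith (Real.toNNReal a⁻¹) (J ∘L V.subtypeL) :=
    AddMonoidHomClass.antilipschitz_of_bound _ fun u => by
      rw [Real.coe_toNNReal _ (by positivity), inv_mul_eq_div, le_div_iff₀ ha, mul_comm]
      exact hle u u.2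
  have hcl := hanti.isClosed_range (J ∘L V.subtypeL).uniformContinuous
  have e1 : Set.range (J ∘L V.subtypeL) = (V.map (J : E →ₗ[𝕜] F) : Submodule 𝕜 F) := by
    ext y; simp
  have hmem : ∀ v, J v ∈ V.map (J : E →ₗ[𝕜] F) ↔ v ∈ V := fun v =>
    ⟨fun ⟨_, hw, e⟩ => hJ e ▸ hw, fun h => ⟨v, h, rfl⟩⟩
  refine ⟨V.map (J : E →ₗ[𝕜] F), e1 ▸ hcl, ⟨g 0, hg0 0, (hmem _).2 (hgV 0)⟩, fun v hv hvM => ?_⟩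
  by_contra! H
  obtain ⟨h1, h2⟩ := J.hasSum_norm_sq_of_mem_closure_span hg hJg ((hmem v).1 hvM)
  have hbound : ∀ n, ‖J (g n)‖ * ‖v‖ ≤ ‖J v‖ := fun n => by
    simpa [hg.1 n] using H (g n) ((hmem _).2 (hgV n))
  have hvpos : 0 < ‖v‖ := norm_pos_iff.2 hv
  obtain ⟨n, hn⟩ : ∃ n, ⟪g n, v⟫_𝕜 ≠ 0 := by
    by_contra! h0
    simp only [h0, norm_zero, ne_eq, OfNat.ofNat_ne_zero, not_false_eq_true, zero_pow] at h1
    exact hvpos.ne' (pow_eq_zero_iff two_ne_zero |>.1 (h1.unique hasSum_zero))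
  -- Comparing with `g (m + 1)` makes the bound at `g m` strict; Parseval with one nonzero
  -- coefficient then gives `‖J v‖ < ‖J v‖`.
  have hlt : ∀ m, ‖J (g m)‖ < ‖J v‖ / ‖v‖ := fun m =>
    (hmono m.lt_succ_self).trans_le ((le_div_iff₀ hvpos).2 (hbound _))
  have hfinal : ‖J v‖ ^ 2 < ‖v‖ ^ 2 * (‖J v‖ / ‖v‖) ^ 2 := by
    refine hasSum_lt (i := n) (fun m => ?_) ?_ h2 (h1.mul_right _)
    · dsimp only
      gcongr
      exact (hlt m).le
    · have := norm_pos_iff.2 hn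
      gcongr
      exact hlt n
  rw [← mul_pow, mul_div_cancel₀ _ hvpos.ne'] at hfinal
  exact lt_irrefl _ hfinal

end ContinuousLinearMap

/-! ### The graph as a Hilbert space and its projections -/

namespace LinearPMap

variable {H₁ H₂ : Type*} [NormedAddCommGroup H₁] [InnerProductSpace ℂ H₁]
  [NormedAddCommGroup H₂] [InnerProductSpace ℂ H₂]

/-- The graph of `T` with the Hilbert space norm of `H₁ × H₂`. -/
def l2Graph (T : H₁ →ₗ.[ℂ] H₂) : Submodule ℂ (WithLp 2 (H₁ × H₂)) :=
  T.graph.comap (WithLp.prodContinuousLinearEquiv 2 ℂ H₁ H₂ : WithLp 2 (H₁ × H₂) →ₗ[ℂ] H₁ × H₂)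

/-- The first projection of the graph of `T`. -/
def l2GraphFst (T : H₁ →ₗ.[ℂ] H₂) : T.l2Graph →L[ℂ] H₁ :=
  (ContinuousLinearMap.fst ℂ H₁ H₂ ∘L
    (WithLp.prodContinuousLinearEquiv 2 ℂ H₁ H₂ : WithLp 2 (H₁ × H₂) →L[ℂ] H₁ × H₂)) ∘L
      T.l2Graph.subtypeL

/-- The second projection of the graph of `T`. -/
def l2GraphSnd (T : H₁ →ₗ.[ℂ] H₂) : T.l2Graph →L[ℂ] H₂ :=
  (ContinuousLinearMap.snd ℂ H₁ H₂ ∘L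
    (WithLp.prodContinuousLinearEquiv 2 ℂ H₁ H₂ : WithLp 2 (H₁ × H₂) →L[ℂ] H₁ × H₂)) ∘L
      T.l2Graph.subtypeL

/-- The point `(x, T x)` of the graph of `T`. -/
def l2GraphMk (T : H₁ →ₗ.[ℂ] H₂) (x : T.domain) : T.l2Graph :=
  ⟨WithLp.toLp 2 ((x : H₁), T x), T.mem_graph x⟩

@[simp]
theorem l2GraphFst_mk (T : H₁ →ₗ.[ℂ] H₂) (x : T.domain) : T.l2GraphFst (T.l2GraphMk x) = x :=
  rfl

@[simp]
theorem l2GraphSnd_mk (T : H₁ →ₗ.[ℂ] H₂) (x : T.domain) : T.l2GraphSnd (T.l2GraphMk x) = T x :=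
  rfl

theorem norm_l2GraphMk_sq (T : H₁ →ₗ.[ℂ] H₂) (x : T.domain) :
    ‖T.l2GraphMk x‖ ^ 2 = ‖(x : H₁)‖ ^ 2 + ‖T x‖ ^ 2 :=
  WithLp.prod_norm_sq_eq_of_L2 (WithLp.toLp 2 ((x : H₁), T x))

theorem norm_le_norm_l2GraphMk (T : H₁ →ₗ.[ℂ] H₂) (x : T.domain) : ‖T x‖ ≤ ‖T.l2GraphMk x‖ :=
  le_of_sq_le_sq (by rw [norm_l2GraphMk_sq]; linarith [sq_nonneg ‖(x : H₁)‖]) (norm_nonneg _)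

theorem norm_l2GraphMk_le (T : H₁ →ₗ.[ℂ] H₂) (x : T.domain) :
    ‖T.l2GraphMk x‖ ≤ ‖(x : H₁)‖ + ‖T x‖ :=
  le_of_sq_le_sq (by
    rw [norm_l2GraphMk_sq]
    nlinarith [mul_nonneg (norm_nonneg (x : H₁)) (norm_nonneg (T x))]) (by positivity)

theorem l2GraphMk_surjective (T : H₁ →ₗ.[ℂ] H₂) : Function.Surjective T.l2GraphMk := by
  rintro ⟨p, hp⟩
  obtain ⟨x, hx1, hx2⟩ := (mem_graph_iff T).1 hp
  exact ⟨x, Subtype.ext (WithLp.ofLp_injective 2 (Prod.ext hx1 hx2))⟩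

theorem l2GraphFst_injective (T : H₁ →ₗ.[ℂ] H₂) : Function.Injective T.l2GraphFst := by
  intro a b h
  obtain ⟨x, rfl⟩ := T.l2GraphMk_surjective a
  obtain ⟨y, rfl⟩ := T.l2GraphMk_surjective b
  rw [show x = y from Subtype.ext h]

theorem range_l2GraphFst (T : H₁ →ₗ.[ℂ] H₂) : Set.range T.l2GraphFst = T.domain := by
  ext x
  constructor
  · rintro ⟨g, rfl⟩
    obtain ⟨y, rfl⟩ := T.l2GraphMk_surjective g
    exact y.2
  · exact fun h => ⟨T.l2GraphMk ⟨x, h⟩, rfl⟩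

/-- The graph norm dominates `‖T x‖`, and a lower bound for the first projection controls it by
`‖x‖`. -/
theorem isBoundedOnDomain_of_antilipschitzWith {T : H₁ →ₗ.[ℂ] H₂} {K : NNReal}
    (h : AntilipschitzWith K T.l2GraphFst) : T.IsBoundedOnDomain :=
  ⟨K, fun x => (T.norm_le_norm_l2GraphMk x).trans
    (by simpa using h.le_mul_norm (_root_.map_zero _) (T.l2GraphMk x))⟩

theorem completeSpace_l2Graph [CompleteSpace H₁] [CompleteSpace H₂] {T : H₁ →ₗ.[ℂ] H₂}
    (hT : T.IsClosed) : CompleteSpace T.l2Graph :=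
  (IsClosed.preimage (WithLp.prodContinuousLinearEquiv 2 ℂ H₁ H₂).continuous hT).completeSpace_coe

/-- An absolutely minimum attaining unbounded closed operator has a compact graph projection. -/
theorem IsAbsolutelyMinimumAttaining.isCompactOperator_l2GraphFst
    [CompleteSpace H₁] [CompleteSpace H₂] {T : H₁ →ₗ.[ℂ] H₂}
    (hAM : T.IsAbsolutelyMinimumAttaining) (hT : T.IsClosed) (hunb : ¬ T.IsBoundedOnDomain) :
    IsCompactOperator T.l2GraphFst := by
  have := completeSpace_l2Graph hT
  by_contra hcomp
  obtain ⟨M, hMcl, ⟨g, hg0, hgM⟩, hM⟩ := T.l2GraphFst.exists_closed_not_norm_attaining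
    T.l2GraphFst_injective (fun ⟨K, hK⟩ => hunb (isBoundedOnDomain_of_antilipschitzWith hK)) hcomp
  obtain ⟨g, rfl⟩ := T.l2GraphMk_surjective g
  have hne : (T.domRestrict M).domain ≠ ⊥ := by
    refine (Submodule.ne_bot_iff _).2 ⟨(g : H₁), ⟨hgM, g.2⟩, fun h => hg0 ?_⟩
    exact T.l2GraphFst_injective (by simpa using h)
  obtain ⟨⟨x₀, hx₀M, hx₀D⟩, hx₀1, hx₀⟩ := hAM M hMcl hne
  have hmin : ∀ y : T.domain, (y : H₁) ∈ M → ‖(y : H₁)‖ = 1 → ‖T ⟨x₀, hx₀D⟩‖ ≤ ‖T y‖ := by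
    intro y hyM hy1
    have h1 : T.domRestrict M ⟨x₀, hx₀M, hx₀D⟩ = T ⟨x₀, hx₀D⟩ := domRestrict_apply rfl
    rw [← h1, hx₀]
    refine csInf_le ⟨0, ?_⟩ ⟨⟨y, hyM, y.2⟩, hy1, congrArg norm (domRestrict_apply rfl)⟩
    rintro _ ⟨z, -, rfl⟩
    exact norm_nonneg _
  have hscaled : ∀ y : T.domain, (y : H₁) ∈ M → ‖T ⟨x₀, hx₀D⟩‖ * ‖(y : H₁)‖ ≤ ‖T y‖ := by
    intro y hyM
    rcases eq_or_ne (y : H₁) 0 with h | h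
    · simp [h]
    · have hn : 0 < ‖(y : H₁)‖ := norm_pos_iff.2 h
      have := hmin (((‖(y : H₁)‖⁻¹ : ℝ) : ℂ) • y) (M.smul_mem _ hyM) (by
        rw [Submodule.coe_smul, norm_smul, Complex.norm_real, norm_inv, norm_norm,
          inv_mul_cancel₀ hn.ne'])
      rwa [LinearPMap.map_smul, norm_smul, Complex.norm_real, norm_inv, norm_norm,
        inv_mul_eq_div, le_div_iff₀ hn] at this
  have hx₀1 : ‖x₀‖ = 1 := hx₀1
  obtain ⟨h, hhM, hlt⟩ := hM (T.l2GraphMk ⟨x₀, hx₀D⟩)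
    (fun h => by
      have := congrArg (fun g => ‖T.l2GraphFst g‖) h
      simp [hx₀1] at this) hx₀M
  obtain ⟨y, rfl⟩ := T.l2GraphMk_surjective h
  -- As `‖x₀‖ = 1`, squaring gives `‖y‖² + ‖T y‖² < ‖y‖² (1 + ‖T x₀‖²)`, against `hscaled`.
  have hsq := pow_lt_pow_left₀ hlt (by positivity) two_ne_zero
  have hy := pow_le_pow_left₀ (by positivity) (hscaled y hhM) 2
  rw [mul_pow, mul_pow, norm_l2GraphMk_sq, norm_l2GraphMk_sq, l2GraphFst_mk, l2GraphFst_mk,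
    hx₀1] at hsq
  rw [mul_pow] at hy
  nlinarith

/-! ### From the compact graph projection to the Moore-Penrose inverse -/

/-- If the graph projection is compact, `T` is bounded below on `N(T)ᗮ`. -/
theorem exists_pos_mul_norm_le_of_isCompactOperator {T : H₁ →ₗ.[ℂ] H₂} (hT : T.IsClosed)
    (hcomp : IsCompactOperator T.l2GraphFst) :
    ∃ c > 0, ∀ x : T.domain, (x : H₁) ∈ T.nullSpaceᗮ → c * ‖(x : H₁)‖ ≤ ‖T x‖ := by
  by_contra! H
  have hunit : ∀ n : ℕ, ∃ x : T.domain, (x : H₁) ∈ T.nullSpaceᗮ ∧ ‖(x : H₁)‖ = 1 ∧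
      ‖T x‖ ≤ 1 / ((n : ℝ) + 1) := by
    intro n
    obtain ⟨x, hx, hlt⟩ := H (1 / ((n : ℝ) + 1)) (by positivity)
    have hn : 0 < ‖(x : H₁)‖ := by
      by_contra! h0
      rw [le_antisymm h0 (norm_nonneg _), mul_zero] at hlt
      exact absurd hlt (norm_nonneg _).not_gt
    refine ⟨((‖(x : H₁)‖⁻¹ : ℝ) : ℂ) • x, Submodule.smul_mem _ _ hx, ?_, ?_⟩
    · rw [Submodule.coe_smul, norm_smul, Complex.norm_real, norm_inv, norm_norm,
        inv_mul_cancel₀ hn.ne']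
    · rw [LinearPMap.map_smul, norm_smul, Complex.norm_real, norm_inv, norm_norm,
        inv_mul_eq_div, div_le_iff₀ hn]
      exact hlt.le
  choose x hxN hx1 hTx using hunit
  -- Radius 2 suffices: the graph norm of `x n` is at most `‖x n‖ + ‖T (x n)‖ ≤ 1 + 1`.
  obtain ⟨K, hK, hKsub⟩ := IsCompactOperator.image_closedBall_subset_compact
    (f := (T.l2GraphFst : T.l2Graph →ₗ[ℂ] H₁)) hcomp 2
  have hxK : ∀ n, (x n : H₁) ∈ K := fun n => by
    refine hKsub ⟨T.l2GraphMk (x n), ?_, rfl⟩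
    rw [mem_closedBall_zero_iff]
    have h1 : 1 / ((n : ℝ) + 1) ≤ 1 := by
      rw [div_le_one (by positivity)]
      linarith [n.cast_nonneg (α := ℝ)]
    linarith [T.norm_l2GraphMk_le (x n), hx1 n, hTx n]
  obtain ⟨a, -, φ, hφ, hlim⟩ := hK.tendsto_subseq hxK
  have hT0 : Tendsto (fun n => T (x n)) atTop (𝓝 0) :=
    squeeze_zero_norm hTx tendsto_one_div_add_atTop_nhds_zero_nat
  -- Closedness of `T` puts the limit in `N(T)`; it also lies in `N(T)ᗮ` and has norm 1.
  have hgraph : (a, (0 : H₂)) ∈ T.graph :=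
    hT.mem_of_tendsto (hlim.prodMk_nhds (hT0.comp hφ.tendsto_atTop))
      (Eventually.of_forall fun n => T.mem_graph (x (φ n)))
  have haN : a ∈ T.nullSpace := by
    obtain ⟨y, hy, hy0⟩ := (mem_graph_iff T).1 hgraph
    obtain rfl : (y : H₁) = a := hy
    exact mem_nullSpace.2 ⟨y.2, hy0⟩
  have haN' : a ∈ T.nullSpaceᗮ := T.nullSpace.isClosed_orthogonal.mem_of_tendsto hlim
    (Eventually.of_forall fun n => hxN (φ n))
  have ha1 : ‖a‖ = 1 := tendsto_nhds_unique hlim.norm (by simp [hx1])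
  have : a = 0 := inner_self_eq_zero.1 (Submodule.inner_right_of_mem_orthogonal haN haN')
  simp [this] at ha1

theorem moorePenrose_mem_orthogonal (T : H₁ →ₗ.[ℂ] H₂) (y : T.moorePenrose.domain) :
    T.moorePenrose y ∈ T.nullSpaceᗮ := by
  obtain ⟨x, z, -, hx, e⟩ := mem_graph_moorePenrose.1 (T.moorePenrose.mem_graph y)
  have e2 : T.moorePenrose y = x := congrArg Prod.snd e
  rwa [e2]

variable [CompleteSpace H₁] [CompleteSpace H₂]

/-- The second projection is bounded below on the part of the graph over `N(T)ᗮ`, so its image there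
is closed. That image is all of `R(T)`, since projecting `x` to `N(T)ᗮ` does not change `T x`. -/
theorem isClosed_rangeSpace_of_bounded_below {T : H₁ →ₗ.[ℂ] H₂} (hT : T.IsClosed) {c : ℝ}
    (hc : 0 < c) (h : ∀ x : T.domain, (x : H₁) ∈ T.nullSpaceᗮ → c * ‖(x : H₁)‖ ≤ ‖T x‖) :
    _root_.IsClosed (T.rangeSpace : Set H₂) := by
  have := completeSpace_l2Graph hT
  let V := T.nullSpaceᗮ.comap (T.l2GraphFst : T.l2Graph →ₗ[ℂ] H₁)
  have hV : CompleteSpace V :=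
    (T.nullSpace.isClosed_orthogonal.preimage T.l2GraphFst.continuous).completeSpace_coe
  have hanti : AntilipschitzWith (Real.toNNReal (c⁻¹ + 1)) (T.l2GraphSnd ∘L V.subtypeL) :=
    AddMonoidHomClass.antilipschitz_of_bound _ fun g => by
      obtain ⟨g, hg⟩ := g
      obtain ⟨x, rfl⟩ := T.l2GraphMk_surjective g
      rw [Real.coe_toNNReal _ (by positivity)]
      have h1 : ‖(x : H₁)‖ ≤ c⁻¹ * ‖T x‖ := by
        rw [inv_mul_eq_div, le_div_iff₀ hc, mul_comm]
        exact h x hg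
      calc ‖T.l2GraphMk x‖ ≤ ‖(x : H₁)‖ + ‖T x‖ := T.norm_l2GraphMk_le x
        _ ≤ (c⁻¹ + 1) * ‖T x‖ := by linarith
  have hcl := hanti.isClosed_range (T.l2GraphSnd ∘L V.subtypeL).uniformContinuous
  convert hcl using 1
  ext y
  constructor
  · rintro ⟨x, rfl⟩
    have hmp := isMoorePenroseInverse_moorePenrose hT
    obtain ⟨h1, -⟩ := hmp.inverse_apply x
    obtain ⟨h2, e2⟩ := hmp.apply_inverse ⟨T x, h1⟩
    refine ⟨⟨T.l2GraphMk ⟨_, h2⟩, T.moorePenrose_mem_orthogonal ⟨T x, h1⟩⟩, ?_⟩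
    change T ⟨_, h2⟩ = T x
    rw [e2]
    exact Submodule.starProjection_eq_self_iff.2
      (T.rangeSpace.le_topologicalClosure (T.mem_rangeSpace x))
  · rintro ⟨⟨g, -⟩, rfl⟩
    obtain ⟨x, rfl⟩ := T.l2GraphMk_surjective g
    exact T.mem_rangeSpace x

/-- Apply the lower bound at `T† y`: `T T† y` is an orthogonal projection of `y`, hence no longer
than `y`. -/
theorem norm_moorePenrose_le {T : H₁ →ₗ.[ℂ] H₂} (hT : T.IsClosed) {c : ℝ} (hc : 0 < c)
    (h : ∀ x : T.domain, (x : H₁) ∈ T.nullSpaceᗮ → c * ‖(x : H₁)‖ ≤ ‖T x‖)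
    (y : T.moorePenrose.domain) : ‖T.moorePenrose y‖ ≤ c⁻¹ * ‖(y : H₂)‖ := by
  obtain ⟨h1, e1⟩ := (isMoorePenroseInverse_moorePenrose hT).apply_inverse y
  rw [inv_mul_eq_div, le_div_iff₀ hc, mul_comm]
  refine (h ⟨_, h1⟩ (T.moorePenrose_mem_orthogonal y)).trans ?_
  rw [e1]
  exact Submodule.norm_starProjection_apply_le _ _

/-- The Moore-Penrose inverse of a closed operator with compact graph projection is compact. -/
theorem isCompactEverywhereDefined_moorePenrose {T : H₁ →ₗ.[ℂ] H₂} (hT : T.IsClosed)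
    (hcomp : IsCompactOperator T.l2GraphFst) : T.moorePenrose.IsCompactEverywhereDefined := by
  have hmp := isMoorePenroseInverse_moorePenrose hT
  obtain ⟨c, hc, hbelow⟩ := exists_pos_mul_norm_le_of_isCompactOperator hT hcomp
  have : CompleteSpace T.rangeSpace :=
    (isClosed_rangeSpace_of_bounded_below hT hc hbelow).completeSpace_coe
  have hdom : T.moorePenrose.domain = ⊤ := by
    rw [hmp.domain_eq, Submodule.sup_orthogonal_of_hasOrthogonalProjection]
  have hmem : ∀ y, y ∈ T.moorePenrose.domain := fun y => hdom ▸ Submodule.mem_top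
  let K : H₂ →L[ℂ] H₁ := LinearMap.mkContinuous
    (T.moorePenrose.toFun ∘ₗ LinearMap.id.codRestrict T.moorePenrose.domain hmem) c⁻¹
    fun y => norm_moorePenrose_le hT hc hbelow ⟨y, hmem y⟩
  have hK : ∀ y, K y = T.moorePenrose ⟨y, hmem y⟩ := fun y => rfl
  -- `L y = (T† y, T T† y)` lifts `K` to the graph, so `K` is the compact first projection after a
  -- bounded map.
  let L : H₂ →L[ℂ] WithLp 2 (H₁ × H₂) :=
    ((WithLp.prodContinuousLinearEquiv 2 ℂ H₁ H₂).symm : H₁ × H₂ →L[ℂ] WithLp 2 (H₁ × H₂)) ∘L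
      K.prod T.rangeSpace.topologicalClosure.starProjection
  have hL : ∀ y, L y ∈ T.l2Graph := fun y => by
    obtain ⟨h1, e1⟩ := hmp.apply_inverse ⟨y, hmem y⟩
    exact (mem_graph_iff T).2 ⟨⟨_, h1⟩, rfl, e1⟩
  refine ⟨K, hcomp.comp_clm (L.codRestrict T.l2Graph hL), ?_⟩
  exact LinearPMap.ext hdom fun y hy _ => rfl

end LinearPMap

/-- The range of a compact operator is separable. -/
theorem IsCompactOperator.isSeparable_range {𝕜 E F : Type*} [NontriviallyNormedField 𝕜]
    [NormedAddCommGroup E] [NormedSpace 𝕜 E] [NormedAddCommGroup F] [NormedSpace 𝕜 F]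
    {f : E →L[𝕜] F} (hf : IsCompactOperator f) : TopologicalSpace.IsSeparable (Set.range f) := by
  have hf' : IsCompactOperator (f : E →ₗ[𝕜] F) := hf
  choose K hK hsub using fun n : ℕ => hf'.image_closedBall_subset_compact (n : ℝ)
  refine (TopologicalSpace.IsSeparable.iUnion fun n => (hK n).isSeparable).mono ?_
  rintro _ ⟨x, rfl⟩
  obtain ⟨n, hn⟩ := exists_nat_ge ‖x‖
  exact Set.mem_iUnion.2 ⟨n, hsub n ⟨x, mem_closedBall_zero_iff.2 hn, rfl⟩⟩

end

theorem theorem4p10 {H : Type*} [NormedAddCommGroup H] [InnerProductSpace ℂ H] [CompleteSpace H]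
    (T : H →ₗ.[ℂ] H) (hdense : Dense (T.domain : Set H)) (hclosed : T.IsClosed)
    (hunbounded : ¬ T.IsBoundedOnDomain) (hAM : T.IsAbsolutelyMinimumAttaining) :
    T.moorePenrose.IsCompactEverywhereDefined ∧
      TopologicalSpace.IsSeparable ((T.nullSpaceᗮ : Submodule ℂ H) : Set H) ∧
      TopologicalSpace.IsSeparable (T.rangeSpace : Set H) := by
  have hcomp := hAM.isCompactOperator_l2GraphFst hclosed hunbounded
  -- Density of `D(T)` makes all of `H` separable, so both subspaces are separable as subsets.
  have hsep : TopologicalSpace.IsSeparable (Set.univ : Set H) := by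
    have h := hcomp.isSeparable_range.closure
    rwa [T.range_l2GraphFst, hdense.closure_eq] at h
  exact ⟨LinearPMap.isCompactEverywhereDefined_moorePenrose hclosed hcomp,
    hsep.mono (Set.subset_univ _), hsep.mono (Set.subset_univ _)⟩
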